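/- Let $d\ge 2$. The $d$-ary dendrimer $D_{n,d}$ is the tree on $\{1,\dots,n\}$ defined inductively: $D_{1,d}$ is the single node $1$, and $D_{n,d}$ is obtained from $D_{n-1,d}$ by attaching a leaf $n$ to the smallest-numbered node of degree at most $d$. For a finite connected graph $G$ the Wiener polynomial is $W(G;q)=\sum_{\{u,v\}}q^{d(u,v)}$, the sum being over all unordered pairs of distinct vertices, where $d(u,v)$ is the graph distance. For $k\ge 0$ put $$n_k=2+(d+1)\frac{d^k-1}{d-1},\qquad m_k=3+2d\,\frac{d^k-1}{d-1}.$$ Let $n\ge 2$, let $k\ge 0$ be the integer with $n_k\le n<n_{k+1}$, and let $\lambda(n)=(l_{k+1},l_k,\dots,l_0)$ be the base-$d$ digits ($0\le l_i<d$) of $n-n_k+(d-1)d^k=\sum_{i=0}^{k+1}l_id^i$. Put $\lambda_i(n)=l_0+l_1d+\cdots+l_{i-1}d^{i-1}$. Then $$W(D_{n,d};q)=\sum_{i=0}^{k}d^i(n-n_i+1)\,q^{2i+1}+\sum_{i=0}^{k'}\left(d^{2i}\left\lfloor\frac{n-m_i}{d^{i+1}}\right\rfloor\binom{d+1}{2}+d^{2i}\binom{l_i+1}{2}+d^i(l_i+1)(\lambda_i(n)+1)\right)q^{2i+2},$$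 where $k'=k-1$ if $n_k\le n<m_k$ and $k'=k$ if $m_k\le n<n_{k+1}$ (for $k'=-1$ the second sum is empty). -/

import Mathlib

open Polynomial

/-- The Wiener polynomial `∑ q^{d(u,v)}`, summed over all unordered pairs `{u,v}` of distinct
vertices of a finite graph. -/
noncomputable def wienerPoly {V : Type*} [Fintype V] [DecidableEq V] (G : SimpleGraph V) : ℤ[X] :=
  ∑ e : Sym2 V with ¬ e.IsDiag,
    X ^ (Sym2.lift ⟨fun u v => G.dist u v, fun _ _ => G.dist_comm⟩ e)

/-- The edges of the `d`-ary dendrimer on the nodes `1, …, n`, as a graph on all of `ℕ`: starting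
from the single node `1`, the new node `n + 2` is joined to the smallest node among
`1, …, n + 1` whose degree so far is at most `d`. -/
noncomputable def dendrimerEdges (d : ℕ) : ℕ → SimpleGraph ℕ
  | 0 => ⊥
  | 1 => ⊥
  | n + 2 => dendrimerEdges d (n + 1) ⊔
      SimpleGraph.edge
        (sInf {v : ℕ | 1 ≤ v ∧ v ≤ n + 1 ∧ ((dendrimerEdges d (n + 1)).neighborSet v).ncard ≤ d})
        (n + 2)

/-- The `d`-ary dendrimer `D_{n,d}`, with vertex set `{1, …, n}`. -/
noncomputable def dendrimer (n d : ℕ) : SimpleGraph (Set.Icc 1 n) :=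
  (dendrimerEdges d n).induce (Set.Icc 1 n)

/-- `n_k = 2 + (d + 1) (d^k - 1) / (d - 1)`, the quotient being written as a geometric sum. -/
def nIdx (d k : ℕ) : ℕ := 2 + (d + 1) * ∑ j ∈ Finset.range k, d ^ j

/-- `m_k = 3 + 2 d (d^k - 1) / (d - 1)`, the quotient being written as a geometric sum. -/
def mIdx (d k : ℕ) : ℕ := 3 + 2 * d * ∑ j ∈ Finset.range k, d ^ j

/-- For `n_k ≤ m < n_{k+1}`, the number `m - n_k + (d - 1) d^k` whose base-`d` digits
`l_{k+1}, …, l_0` form the label of the node `m`. -/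
def labelValue (d k m : ℕ) : ℕ := m - nIdx d k + (d - 1) * d ^ k

/-- The digit `l_i` of the label of the node `m`, where `n_k ≤ m < n_{k+1}`. -/
def labelDigit (d k m i : ℕ) : ℕ := labelValue d k m / d ^ i % d

/-- `λ_i(m) = l_0 + l_1 d + ⋯ + l_{i-1} d^{i-1}`, where `n_k ≤ m < n_{k+1}`. -/
def labelTail (d k m i : ℕ) : ℕ := ∑ j ∈ Finset.range i, labelDigit d k m j * d ^ j

/-- The digits lie in `{0, …, d - 1}`. -/
theorem labelDigit_lt {d : ℕ} (hd : 2 ≤ d) (k m i : ℕ) : labelDigit d k m i < d :=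
  Nat.mod_lt _ (by omega)

/-- The low-order digits represent the label value modulo the corresponding power of `d`. -/
theorem labelTail_eq_mod (d k m i : ℕ) : labelTail d k m i = labelValue d k m % d ^ i := by
  induction i with
  | zero => simp [labelTail, Nat.mod_one]
  | succ i ih =>
    rw [labelTail, Finset.sum_range_succ, ← labelTail, ih, labelDigit, pow_succ, Nat.mod_mul,
      Nat.mul_comm]

/-- The `k + 2` digits `l_{k+1}, …, l_0` are the whole base-`d` expansion of the label value. -/
theorem sum_labelDigit {d k m : ℕ} (hd : 2 ≤ d) (hm : m < nIdx d (k + 1)) :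
    ∑ i ∈ Finset.range (k + 2), labelDigit d k m i * d ^ i = labelValue d k m := by
  have h := labelTail_eq_mod d k m (k + 2)
  rw [labelTail] at h
  rw [h]
  apply Nat.mod_eq_of_lt
  have h1 : nIdx d (k + 1) = nIdx d k + (d + 1) * d ^ k := by
    simp only [nIdx, Finset.sum_range_succ]; ring
  have hp : 0 < d ^ k := pow_pos (by omega) k
  have h2 : m - nIdx d k < (d + 1) * d ^ k := by
    have : 0 < (d + 1) * d ^ k := by positivity
    omega
  have h3 : (d + 1) * d ^ k + (d - 1) * d ^ k ≤ d ^ (k + 2) := by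
    rw [← Nat.add_mul, show d + 1 + (d - 1) = 2 * d by omega, pow_add, mul_comm (d ^ k)]
    exact Nat.mul_le_mul_right _ (by nlinarith)
  unfold labelValue
  omega

/-- The right-hand side of the formula: the odd coefficients have `i = 0, …, k`, and the even
ones have `i = 0, …, r - 1`. All differences are taken in `ℤ`, where `/` by a positive number is
division rounded down. -/
noncomputable def dendrimerFormula (d n k r : ℕ) : ℤ[X] :=
  ∑ i ∈ Finset.range (k + 1), C ((d : ℤ) ^ i * ((n : ℤ) - nIdx d i + 1)) * X ^ (2 * i + 1) +
  ∑ i ∈ Finset.range r,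
    C ((d : ℤ) ^ (2 * i) * (((n : ℤ) - mIdx d i) / (d : ℤ) ^ (i + 1)) * ((d + 1).choose 2 : ℤ) +
        (d : ℤ) ^ (2 * i) * ((labelDigit d k n i + 1).choose 2 : ℤ) +
        (d : ℤ) ^ i * ((labelDigit d k n i : ℤ) + 1) * ((labelTail d k n i : ℤ) + 1)) *
      X ^ (2 * i + 2)

/-! Number the nodes from 0. Truncated subtraction makes `(x - 2) / d` the parent of `x`, giving the
root its extra child 1. Ordering each pair by index turns the Wiener polynomial into the sum over `x
< n` of `rowPoly d x`.

The key is `rowPoly_eq`: with `z` the parent of `x`, the row of `x` is `q + (1 + s) q^2 + d q^2`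
times the row of `z`, where `s` is the sibling index. Every node below `z` has `d` children (the
root one more), and replacing both ends of a pair by children usually adds 2 to the distance; the
exceptions, where one end is an ancestor of the other, cancel by induction.

Unrolled, the row of `x` has coefficients `d^i` at `q^(2i+1)` and `d^i` times a base-`d` digit plus
one at `q^(2i+2)`, as long as the `i`-th ancestor has index at least 1, respectively 2. These
thresholds are `n_i` and `m_i`. Summing over `x` counts terms in odd degrees and is a digit sum in
even degrees; modulo `d^(i+1)` the label agrees with `n - m_i`. -/

/-- With the node `v` of the dendrimer indexed by `x = v - 1`, the index of the parent of `v`.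
The root is its own parent. -/
def parentIndex (d x : ℕ) : ℕ := (x - 2) / d

theorem parentIndex_lt {d x : ℕ} (hx : x ≠ 0) : parentIndex d x < x :=
  lt_of_le_of_lt (Nat.div_le_self _ _) (by omega)

theorem parentIndex_le (d x : ℕ) : parentIndex d x ≤ x :=
  (Nat.div_le_self _ _).trans (by omega)

/-- The distance in the infinite dendrimer, computed by moving the larger index to its parent. -/
def treeDist (d x y : ℕ) : ℕ :=
  if x = y then 0
  else if y < x then treeDist d (parentIndex d x) y + 1
  else treeDist d x (parentIndex d y) + 1
termination_by x + y
decreasing_by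
  · have := parentIndex_lt (d := d) (x := x) (by omega)
    omega
  · have := parentIndex_lt (d := d) (x := y) (by omega)
    omega

theorem treeDist_self (d x : ℕ) : treeDist d x x = 0 := by
  rw [treeDist, if_pos rfl]

theorem treeDist_of_gt {d x y : ℕ} (h : y < x) :
    treeDist d x y = treeDist d (parentIndex d x) y + 1 := by
  rw [treeDist, if_neg (by omega), if_pos h]

theorem treeDist_of_lt {d x y : ℕ} (h : x < y) :
    treeDist d x y = treeDist d x (parentIndex d y) + 1 := by
  rw [treeDist, if_neg (by omega), if_neg (by omega)]

/-- Crossing one edge changes the distance to `z` by at most 1; summed along a walk, this bounds its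
length from below. -/
theorem treeDist_parentIndex (d z y : ℕ) (hy : y ≠ 0) :
    treeDist d z y ≤ treeDist d z (parentIndex d y) + 1 ∧
      treeDist d z (parentIndex d y) ≤ treeDist d z y + 1 := by
  induction z using Nat.strong_induction_on with
  | _ z ih =>
    have hp := parentIndex_lt (d := d) hy
    rcases lt_trichotomy z y with h | rfl | h
    · rw [treeDist_of_lt h]
      omega
    · rw [treeDist_of_gt hp, treeDist_self, treeDist_self]
      omega
    · rw [treeDist_of_gt h, treeDist_of_gt (hp.trans h)]
      have := ih _ (parentIndex_lt (d := d) (x := z) (by omega))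
      omega

/-! ### The greedy construction attaches each node to its arithmetic parent. -/

section Adjacency

/-- `v` is a node at most `n` other than the root, and `u` is its parent. -/
def IsParent (d n u v : ℕ) : Prop := 2 ≤ v ∧ v ≤ n ∧ u = (v - 3) / d + 1

theorem ncard_neighborSet_gt {d n v : ℕ} {G : SimpleGraph ℕ} (hd : 2 ≤ d)
    (hG : ∀ u v, G.Adj u v ↔ IsParent d (n + 1) u v ∨ IsParent d (n + 1) v u)
    (hv : 1 ≤ v) (hlt : v < (n - 1) / d + 1) : d < (G.neighborSet v).ncard := by
  have hle : v * d ≤ n - 1 := (Nat.le_div_iff_mul_le (by omega)).mp (by omega)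
  have hvd : v ≤ v * d := Nat.le_mul_of_pos_right v (by omega)
  have hfin : (G.neighborSet v).Finite := by
    refine (Set.finite_Iic (n + 1)).subset fun u hu => ?_
    rcases (hG v u).mp hu with h | h
    · exact h.2.1
    · have h1 := Nat.div_le_self (v - 3) d
      have := h.2.2
      have := h.2.1
      have := h.1
      simp only [Set.mem_Iic]
      omega
  have hchild : ∀ c, 3 ≤ c → (v - 1) * d + 3 ≤ c → c ≤ v * d + 2 → c ∈ G.neighborSet v := by
    intro c h0 h1 h2
    refine (hG v c).mpr (Or.inl ⟨by omega, by omega, ?_⟩)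
    have : (c - 3) / d = v - 1 := by
      refine Nat.div_eq_of_lt_le (by omega) ?_
      rw [show v - 1 + 1 = v by omega]
      omega
    omega
  have hsucc : (v - 1) * d + d = v * d := by
    rw [← Nat.succ_mul, Nat.succ_eq_add_one, Nat.sub_add_cancel hv]
  rcases eq_or_lt_of_le hv with rfl | hv2
  -- The root has `d + 1` children and no parent; any other saturated node has a parent and `d`
  -- children.
  · have hsub : ((Finset.Icc 2 (d + 2) : Finset ℕ) : Set ℕ) ⊆ G.neighborSet 1 := by
      intro c hc
      rw [Finset.coe_Icc, Set.mem_Icc] at hc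
      rcases eq_or_lt_of_le hc.1 with rfl | h
      · refine (hG 1 2).mpr (Or.inl ⟨le_rfl, by omega, by simp⟩)
      · exact hchild c (by omega) (by omega) (by omega)
    have := Set.ncard_le_ncard hsub hfin
    rw [Set.ncard_coe_finset, Nat.card_Icc] at this
    omega
  · have hp : (v - 3) / d + 1 < v := by
      have := Nat.div_le_self (v - 3) d
      omega
    have hvm : v - 1 ≤ (v - 1) * d := Nat.le_mul_of_pos_right _ (by omega)
    have hsub : ((insert ((v - 3) / d + 1) (Finset.Icc ((v - 1) * d + 3) (v * d + 2)) :
        Finset ℕ) : Set ℕ) ⊆ G.neighborSet v := by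
      intro c hc
      rw [Finset.coe_insert, Finset.coe_Icc, Set.mem_insert_iff, Set.mem_Icc] at hc
      rcases hc with rfl | h
      · exact (hG _ _).mpr (Or.inr ⟨hv2, by omega, rfl⟩)
      · exact hchild c (by omega) (by omega) (by omega)
    have := Set.ncard_le_ncard hsub hfin
    rw [Set.ncard_coe_finset, Finset.card_insert_of_notMem, Nat.card_Icc] at this
    · omega
    · rw [Finset.mem_Icc]
      omega

theorem ncard_neighborSet_le {d n : ℕ} {G : SimpleGraph ℕ} (hd : 2 ≤ d)
    (hG : ∀ u v, G.Adj u v ↔ IsParent d (n + 1) u v ∨ IsParent d (n + 1) v u) :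
    (G.neighborSet ((n - 1) / d + 1)).ncard ≤ d := by
  obtain ⟨a, ha⟩ : ∃ a, (n - 1) / d = a := ⟨_, rfl⟩
  rw [ha]
  have hlt : n - 1 < (a + 1) * d := (Nat.div_lt_iff_lt_mul (by omega)).mp (by omega)
  have hexp : (a + 1) * d = a * d + d := Nat.succ_mul a d
  have hchild : ∀ c, 2 ≤ c → a + 1 = (c - 3) / d + 1 → a * d ≤ c - 3 := by
    intro c h2 h
    exact (Nat.le_div_iff_mul_le (by omega)).mp (by omega)
  rcases Nat.eq_zero_or_pos a with rfl | hpos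
  · have hsub : G.neighborSet (0 + 1) ⊆ ((Finset.Ico 2 (n + 2) : Finset ℕ) : Set ℕ) := by
      intro c hc
      rw [Finset.coe_Ico, Set.mem_Ico]
      rcases (hG _ c).mp hc with h | h
      · exact ⟨h.1, by have := h.2.1; omega⟩
      · have := h.1
        omega
    have := Set.ncard_le_ncard hsub (Finset.finite_toSet _)
    rw [Set.ncard_coe_finset, Nat.card_Ico] at this
    omega
  · have hle : a * d ≤ n - 1 := (Nat.le_div_iff_mul_le (by omega)).mp (by omega)
    have had : a ≤ a * d := Nat.le_mul_of_pos_right _ (by omega)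
    -- One parent and at most `d - 1` children, because `n - 1 < (a + 1) * d`.
    have hsub : G.neighborSet (a + 1) ⊆ ((insert ((a + 1 - 3) / d + 1)
        (Finset.Ico (a * d + 3) (n + 2)) : Finset ℕ) : Set ℕ) := by
      intro c hc
      rw [Finset.coe_insert, Finset.coe_Ico, Set.mem_insert_iff, Set.mem_Ico]
      rcases (hG _ c).mp hc with h | h
      · have := hchild c h.1 h.2.2
        have := h.2.1
        omega
      · exact Or.inl h.2.2
    have := Set.ncard_le_ncard hsub (Finset.finite_toSet _)
    rw [Set.ncard_coe_finset] at this
    have h2 := Finset.card_insert_le ((a + 1 - 3) / d + 1) (Finset.Ico (a * d + 3) (n + 2))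
    rw [Nat.card_Ico] at h2
    omega

theorem dendrimerEdges_adj {d : ℕ} (hd : 2 ≤ d) (n u v : ℕ) :
    (dendrimerEdges d n).Adj u v ↔ IsParent d n u v ∨ IsParent d n v u := by
  induction n generalizing u v with
  | zero =>
    rw [dendrimerEdges, SimpleGraph.bot_adj, false_iff]
    rintro (⟨h1, h2, -⟩ | ⟨h1, h2, -⟩) <;> omega
  | succ n ih =>
    rcases n with _ | n
    · rw [dendrimerEdges, SimpleGraph.bot_adj, false_iff]
      rintro (⟨h1, h2, -⟩ | ⟨h1, h2, -⟩) <;> omega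
    · have hmin : sInf {v : ℕ | 1 ≤ v ∧ v ≤ n + 1 ∧
          ((dendrimerEdges d (n + 1)).neighborSet v).ncard ≤ d} = (n - 1) / d + 1 := by
        refine IsLeast.csInf_eq ⟨⟨Nat.le_add_left _ _, ?_, ncard_neighborSet_le hd ih⟩, ?_⟩
        · have := Nat.div_le_self (n - 1) d
          omega
        · rintro w ⟨hw1, -, hw⟩
          by_contra hlt
          exact absurd hw (not_le.mpr (ncard_neighborSet_gt hd ih hw1 (not_le.mp hlt)))
      rw [dendrimerEdges, hmin, SimpleGraph.sup_adj, ih, SimpleGraph.edge_adj]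
      have h1 := Nat.div_le_self (n - 1) d
      unfold IsParent
      constructor
      · rintro ((⟨h2, h3, h4⟩ | ⟨h2, h3, h4⟩) | ⟨⟨rfl, rfl⟩ | ⟨rfl, rfl⟩, -⟩)
        · exact Or.inl ⟨h2, by omega, h4⟩
        · exact Or.inr ⟨h2, by omega, h4⟩
        · exact Or.inl ⟨by omega, by omega, by simp⟩
        · exact Or.inr ⟨by omega, by omega, by simp⟩
      · rintro (⟨h2, h3, h4⟩ | ⟨h2, h3, h4⟩)
        · rcases eq_or_lt_of_le h3 with rfl | h
          · simp only [Nat.reduceSubDiff] at h4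
            exact Or.inr ⟨Or.inl ⟨h4, rfl⟩, by omega⟩
          · exact Or.inl (Or.inl ⟨h2, by omega, h4⟩)
        · rcases eq_or_lt_of_le h3 with rfl | h
          · simp only [Nat.reduceSubDiff] at h4
            exact Or.inr ⟨Or.inr ⟨rfl, h4⟩, by omega⟩
          · exact Or.inl (Or.inr ⟨h2, by omega, h4⟩)

theorem dendrimer_adj {d n : ℕ} (hd : 2 ≤ d) (u v : Set.Icc 1 n) :
    (dendrimer n d).Adj u v ↔
      (v.1 - 1 ≠ 0 ∧ u.1 - 1 = parentIndex d (v.1 - 1)) ∨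
        (u.1 - 1 ≠ 0 ∧ v.1 - 1 = parentIndex d (u.1 - 1)) := by
  obtain ⟨u, hu1, hu2⟩ := u
  obtain ⟨v, hv1, hv2⟩ := v
  simp only [dendrimer, SimpleGraph.induce_adj, dendrimerEdges_adj hd, IsParent, parentIndex,
    Nat.sub_sub, Nat.reduceAdd]
  omega

end Adjacency

/-! ### Graph distance and the split of the Wiener polynomial into rows. -/

section Distance

theorem treeDist_le_add_length {d n : ℕ} (hd : 2 ≤ d) (z : ℕ) {u v : Set.Icc 1 n}
    (w : (dendrimer n d).Walk u v) :
    treeDist d z (v.1 - 1) ≤ treeDist d z (u.1 - 1) + w.length := by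
  induction w with
  | nil => simp
  | cons h w ih =>
    rw [SimpleGraph.Walk.length_cons]
    rcases (dendrimer_adj hd _ _).mp h with ⟨h0, h1⟩ | ⟨h0, h1⟩
    · have := (treeDist_parentIndex d z _ h0).1
      rw [← h1] at this
      omega
    · have := (treeDist_parentIndex d z _ h0).2
      rw [← h1] at this
      omega

theorem exists_walk_length_eq_treeDist {d n : ℕ} (hd : 2 ≤ d) (s : ℕ) (u v : Set.Icc 1 n)
    (hs : u.1 + v.1 ≤ s) :
    ∃ w : (dendrimer n d).Walk u v, w.length = treeDist d (u.1 - 1) (v.1 - 1) := by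
  induction s generalizing u v with
  | zero =>
    have := u.2.1
    omega
  | succ s ih =>
    have hu := u.2
    have hv := v.2
    rw [Set.mem_Icc] at hu hv
    rcases lt_trichotomy u v with h | rfl | h
    · have h' : u.1 < v.1 := h
      have hp := parentIndex_lt (d := d) (x := v.1 - 1) (by omega)
      let t : Set.Icc 1 n := ⟨parentIndex d (v.1 - 1) + 1, by omega, by omega⟩
      have ht : t.1 = parentIndex d (v.1 - 1) + 1 := rfl
      obtain ⟨w, hw⟩ := ih u t (by omega)
      have hadj : (dendrimer n d).Adj t v :=
        (dendrimer_adj hd _ _).mpr (Or.inl ⟨by omega, by omega⟩)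
      refine ⟨w.concat hadj, ?_⟩
      rw [SimpleGraph.Walk.length_concat, hw, treeDist_of_lt (y := v.1 - 1) (by omega), ht,
        Nat.add_sub_cancel]
    · exact ⟨SimpleGraph.Walk.nil, by rw [treeDist_self, SimpleGraph.Walk.length_nil]⟩
    · have h' : v.1 < u.1 := h
      have hp := parentIndex_lt (d := d) (x := u.1 - 1) (by omega)
      let t : Set.Icc 1 n := ⟨parentIndex d (u.1 - 1) + 1, by omega, by omega⟩
      have ht : t.1 = parentIndex d (u.1 - 1) + 1 := rfl
      obtain ⟨w, hw⟩ := ih t v (by omega)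
      have hadj : (dendrimer n d).Adj u t :=
        (dendrimer_adj hd _ _).mpr (Or.inr ⟨by omega, by omega⟩)
      refine ⟨SimpleGraph.Walk.cons hadj w, ?_⟩
      rw [SimpleGraph.Walk.length_cons, hw, treeDist_of_gt (x := u.1 - 1) (by omega), ht,
        Nat.add_sub_cancel]

theorem dendrimer_dist {d n : ℕ} (hd : 2 ≤ d) (u v : Set.Icc 1 n) :
    (dendrimer n d).dist u v = treeDist d (u.1 - 1) (v.1 - 1) := by
  obtain ⟨w, hw⟩ := exists_walk_length_eq_treeDist hd _ u v le_rfl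
  refine le_antisymm (hw ▸ SimpleGraph.dist_le w) ?_
  obtain ⟨w', hw'⟩ := w.reachable.exists_walk_length_eq_dist
  have := treeDist_le_add_length hd (u.1 - 1) w'
  rwa [treeDist_self, zero_add, hw'] at this

/-- The generating polynomial of the distances from `x` to the smaller indices. -/
noncomputable def rowPoly (d x : ℕ) : ℤ[X] := ∑ y ∈ Finset.range x, X ^ treeDist d x y

theorem wienerPoly_dendrimer {d : ℕ} (hd : 2 ≤ d) (n : ℕ) :
    wienerPoly (dendrimer n d) = ∑ x ∈ Finset.range n, rowPoly d x := by
  simp only [rowPoly]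
  rw [Finset.sum_sigma', wienerPoly]
  symm
  refine Finset.sum_bij (fun a ha => s((⟨a.1 + 1, ?_⟩ : Set.Icc 1 n), ⟨a.2 + 1, ?_⟩)) ?_ ?_ ?_ ?_
  · simp only [Finset.mem_sigma, Finset.mem_range] at ha
    exact ⟨by omega, by omega⟩
  · simp only [Finset.mem_sigma, Finset.mem_range] at ha
    exact ⟨by omega, by omega⟩
  · intro a ha
    simp only [Finset.mem_sigma, Finset.mem_range] at ha
    simp only [Finset.mem_filter, Finset.mem_univ, true_and, Sym2.mk_isDiag_iff, Subtype.ext_iff]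
    omega
  · rintro ⟨a, b⟩ ha ⟨a', b'⟩ ha' h
    simp only [Finset.mem_sigma, Finset.mem_range] at ha ha'
    simp only [Sym2.eq_iff, Subtype.ext_iff] at h
    obtain rfl : a = a' := by omega
    obtain rfl : b = b' := by omega
    rfl
  · intro e he
    induction e using Sym2.ind with
    | _ u v =>
      have hu := u.2
      have hv := v.2
      rw [Set.mem_Icc] at hu hv
      simp only [Finset.mem_filter, Finset.mem_univ, true_and, Sym2.mk_isDiag_iff,
        Subtype.ext_iff] at he
      rcases lt_or_gt_of_ne he with h | h
      · refine ⟨⟨v.1 - 1, u.1 - 1⟩, ?_, ?_⟩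
        · simp only [Finset.mem_sigma, Finset.mem_range]
          omega
        · simp only [Sym2.eq_iff, Subtype.ext_iff]
          omega
      · refine ⟨⟨u.1 - 1, v.1 - 1⟩, ?_, ?_⟩
        · simp only [Finset.mem_sigma, Finset.mem_range]
          omega
        · simp only [Sym2.eq_iff, Subtype.ext_iff]
          omega
  · intro a ha
    rw [Sym2.lift_mk]
    simp only [dendrimer_dist hd, Nat.add_sub_cancel]

end Distance

/-! ### The recursion for a row along the path to the root. -/

section Rows

/-- The position of `x` among its siblings, in the normalisation in which the children of `z` are
`d * z + 2, …, d * z + d + 1`; so it is `-1` at `x = 1`. -/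
def siblingIndex (d x : ℕ) : ℤ := (x : ℤ) - 2 - d * parentIndex d x

/-- Counts the fibres of the parent map: `d` children for each node below the last parent. The extra
2 at the root accounts for node 0, its own parent, and child 1; at `x = 0` the sibling index `-2`
cancels it. -/
theorem sum_range_parentIndex (d : ℕ) (f : ℕ → ℤ[X]) (x : ℕ) :
    ∑ y ∈ Finset.range x, f (parentIndex d y) =
      (d : ℤ[X]) * ∑ z ∈ Finset.range (parentIndex d x), f z + 2 * f 0 +
        (siblingIndex d x : ℤ[X]) * f (parentIndex d x) := by
  induction x with
  | zero => simp [parentIndex, siblingIndex]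
  | succ x ih =>
    rw [Finset.sum_range_succ, ih]
    -- The parent advances exactly when `x` is the last child of its parent.
    have hstep : parentIndex d (x + 1) = parentIndex d x ∨
        (parentIndex d (x + 1) = parentIndex d x + 1 ∧ x = d * parentIndex d x + d + 1) := by
      unfold parentIndex
      rcases Nat.lt_or_ge x 2 with h | h
      · left
        rw [show x - 2 = 0 by omega, show x + 1 - 2 = 0 by omega]
      · obtain ⟨t, rfl⟩ := Nat.exists_eq_add_of_le' h
        rw [show t + 2 + 1 - 2 = t + 1 by omega, show t + 2 - 2 = t by omega, Nat.succ_div]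
        split_ifs with hdvd
        · right
          refine ⟨rfl, ?_⟩
          have h1 := Nat.succ_div_of_dvd hdvd
          have h2 := Nat.mul_div_cancel' hdvd
          rw [h1, mul_add, mul_one] at h2
          omega
        · left
          rfl
    rcases hstep with h | ⟨h, hx⟩
    · rw [siblingIndex, siblingIndex, h]
      push_cast
      ring
    · have hx' : (x : ℤ[X]) = d * (parentIndex d x : ℤ[X]) + d + 1 := by exact_mod_cast hx
      rw [siblingIndex, siblingIndex, h, Finset.sum_range_succ]
      push_cast
      rw [hx']
      ring

theorem rowPoly_zero (d : ℕ) : rowPoly d 0 = 0 := by simp [rowPoly]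

theorem rowPoly_eq (d x : ℕ) (hx : x ≠ 0) :
    rowPoly d x = X + (1 + (siblingIndex d x : ℤ[X])) * X ^ 2 +
      (d : ℤ[X]) * X ^ 2 * rowPoly d (parentIndex d x) := by
  induction x using Nat.strong_induction_on with
  | _ x ih =>
    obtain ⟨z, hz⟩ : ∃ z, parentIndex d x = z := ⟨_, rfl⟩
    have hzx : z < x := hz ▸ parentIndex_lt hx
    have hH := sum_range_parentIndex d (fun y => X ^ treeDist d z y) x
    simp only [hz, treeDist_self, pow_zero, mul_one] at hH
    have hsplit (f : ℕ → ℤ[X]) : ∑ y ∈ Finset.range x, f y =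
        ∑ y ∈ Finset.range z, f y + f z + ∑ y ∈ Finset.Ico (z + 1) x, f y := by
      rw [← Finset.sum_range_succ, Finset.sum_range_add_sum_Ico _ hzx]
    have hrow : rowPoly d x = X * (rowPoly d z + 1 +
        X * ∑ y ∈ Finset.Ico (z + 1) x, X ^ treeDist d z (parentIndex d y)) := by
      have h1 : rowPoly d x = X * ∑ y ∈ Finset.range x, X ^ treeDist d z y := by
        rw [rowPoly, Finset.mul_sum]
        refine Finset.sum_congr rfl fun y hy => ?_
        rw [treeDist_of_gt (Finset.mem_range.mp hy), hz, pow_succ']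
      rw [h1, hsplit, treeDist_self, pow_zero, rowPoly, Finset.mul_sum (Finset.Ico _ _)]
      congr 2
      refine Finset.sum_congr rfl fun y hy => ?_
      rw [treeDist_of_lt (by rw [Finset.mem_Ico] at hy; omega), pow_succ']
    rw [hsplit] at hH
    rw [hrow, hz]
    rcases Nat.eq_zero_or_pos z with rfl | hpos
    · have h0 : parentIndex d 0 = 0 := by simp [parentIndex]
      simp only [Finset.range_zero, Finset.sum_empty, h0, treeDist_self, pow_zero] at hH
      rw [rowPoly_zero]
      linear_combination X ^ 2 * hH
    · obtain ⟨w, hw⟩ : ∃ w, parentIndex d z = w := ⟨_, rfl⟩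
      have hwz : w < z := hw ▸ parentIndex_lt (by omega)
      have hih := ih z hzx (by omega)
      -- Indices `y < z` have parents below `z`, so `z` can be moved to its parent `w`; the fibre
      -- count at `z` and the induction hypothesis then evaluate this sum, and the root terms
      -- cancel.
      have hE : ∑ y ∈ Finset.range z, (X : ℤ[X]) ^ treeDist d z (parentIndex d y) =
          X * ∑ y ∈ Finset.range z, X ^ treeDist d w (parentIndex d y) := by
        rw [Finset.mul_sum]
        refine Finset.sum_congr rfl fun y hy => ?_
        rw [treeDist_of_gt ((parentIndex_le d y).trans_lt (Finset.mem_range.mp hy)), hw, pow_succ']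
      have hHz := sum_range_parentIndex d (fun y => X ^ treeDist d w y) z
      simp only [hw, treeDist_self, pow_zero, mul_one] at hHz
      have hroot : (X : ℤ[X]) ^ treeDist d z 0 = X * X ^ treeDist d w 0 := by
        rw [treeDist_of_gt hpos, hw, pow_succ']
      have hrz : ∑ y ∈ Finset.range z, (X : ℤ[X]) ^ treeDist d z y = rowPoly d z := rfl
      rw [hE, hHz, hw, treeDist_of_gt hwz, hw, treeDist_self, hroot, hrz] at hH
      rw [hw] at hih
      rw [← rowPoly] at hH
      linear_combination X ^ 2 * hH + X * hih

/-- The contribution of the two smallest distances to `rowPoly`. -/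
theorem rowPoly_eq_add (d x : ℕ) :
    rowPoly d x = C (if 1 ≤ x then 1 else 0) * X +
      C (if 2 ≤ x then 1 + (((x - 2) % d : ℕ) : ℤ) else 0) * X ^ 2 +
      (d : ℤ[X]) * X ^ 2 * rowPoly d (parentIndex d x) := by
  rcases Nat.eq_zero_or_pos x with rfl | hpos
  · simp [parentIndex, rowPoly_zero]
  · rw [rowPoly_eq d x (by omega), if_pos (show 1 ≤ x from hpos)]
    have : (1 : ℤ) + siblingIndex d x = if 2 ≤ x then 1 + (((x - 2) % d : ℕ) : ℤ) else 0 := by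
      split_ifs with h
      · have h1 := Nat.mod_add_div (x - 2) d
        zify [h] at h1
        rw [siblingIndex, parentIndex]
        push_cast [h]
        linear_combination -h1
      · obtain rfl : x = 1 := by omega
        simp [siblingIndex, parentIndex]
    rw [← this]
    simp

theorem rowPoly_eq_sum (d K x : ℕ) (hx : (parentIndex d)^[K] x = 0) :
    rowPoly d x = ∑ i ∈ Finset.range K,
      (C ((d : ℤ) ^ i * if 1 ≤ (parentIndex d)^[i] x then 1 else 0) * X ^ (2 * i + 1) +
        C ((d : ℤ) ^ i * if 2 ≤ (parentIndex d)^[i] x then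
          1 + ((((parentIndex d)^[i] x - 2) % d : ℕ) : ℤ) else 0) * X ^ (2 * i + 2)) := by
  induction K generalizing x with
  | zero =>
    obtain rfl : x = 0 := hx
    simp [rowPoly_zero]
  | succ K ih =>
    rw [rowPoly_eq_add d, ih _ hx, Finset.sum_range_succ', Finset.mul_sum, add_comm]
    congr 1
    · refine Finset.sum_congr rfl fun i _ => ?_
      rw [Function.iterate_succ_apply]
      simp only [pow_succ (d : ℤ), C_mul, C_pow,
        show C (d : ℤ) = (d : ℤ[X]) from map_natCast C d]
      ring
    · simp only [Function.iterate_zero_apply, pow_zero, one_mul, mul_zero, zero_add, pow_one]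
      rfl

end Rows

/-! ### Thresholds, digit sums and labels. -/

section Sums

theorem iterate_parentIndex (d i x : ℕ) :
    (parentIndex d)^[i] x = (x - 2 * ∑ j ∈ Finset.range i, d ^ j) / d ^ i := by
  induction i with
  | zero => simp
  | succ i ih =>
    rw [Function.iterate_succ_apply', ih, parentIndex, Finset.sum_range_succ, pow_succ,
      ← Nat.div_div_eq_div_mul, mul_add, ← Nat.sub_sub, mul_comm 2 (d ^ i), Nat.sub_mul_div]

theorem nIdx_eq (d i : ℕ) :
    nIdx d i = 1 + 2 * ∑ j ∈ Finset.range i, d ^ j + d ^ i := by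
  induction i with
  | zero => simp [nIdx]
  | succ i ih =>
    rw [nIdx] at ih ⊢
    rw [Finset.sum_range_succ, pow_succ]
    linarith

theorem mIdx_eq (d i : ℕ) : mIdx d i = 1 + 2 * ∑ j ∈ Finset.range (i + 1), d ^ j := by
  simp only [mIdx, Finset.sum_range_succ', pow_succ, ← Finset.sum_mul, pow_zero]
  ring

theorem one_le_iterate_parentIndex {d : ℕ} (hd : 2 ≤ d) (i x : ℕ) :
    1 ≤ (parentIndex d)^[i] x ↔ nIdx d i ≤ x + 1 := by
  have hp : 0 < d ^ i := by positivity
  rw [iterate_parentIndex, Nat.le_div_iff_mul_le hp, nIdx_eq]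
  omega

theorem two_le_iterate_parentIndex {d : ℕ} (hd : 2 ≤ d) (i x : ℕ) :
    2 ≤ (parentIndex d)^[i] x ↔ mIdx d i ≤ x + 1 := by
  have hp : 0 < d ^ i := by positivity
  rw [iterate_parentIndex, Nat.le_div_iff_mul_le hp, mIdx_eq, Finset.sum_range_succ]
  omega

theorem iterate_parentIndex_sub_two (d i x : ℕ) :
    (parentIndex d)^[i] x - 2 = (x + 1 - mIdx d i) / d ^ i := by
  rw [iterate_parentIndex, mIdx_eq, Finset.sum_range_succ, ← Nat.sub_mul_div]
  congr 1
  rw [mul_comm (d ^ i)]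
  omega

theorem sum_range_ite_le (a n : ℕ) (ha : 1 ≤ a) (han : a ≤ n) (f : ℕ → ℤ) :
    ∑ x ∈ Finset.range n, (if a ≤ x + 1 then f (x + 1 - a) else 0) =
      ∑ t ∈ Finset.range (n - a + 1), f t := by
  induction n, han using Nat.le_induction with
  | base =>
    rw [Nat.sub_self, zero_add, Finset.sum_range_one]
    obtain ⟨b, rfl⟩ := Nat.exists_eq_add_of_le' ha
    rw [Finset.sum_range_succ, Finset.sum_eq_zero, if_pos le_rfl, Nat.sub_self, zero_add]
    intro x hx
    rw [if_neg (by rw [Finset.mem_range] at hx; omega)]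
  | succ n han ih =>
    rw [Finset.sum_range_succ, ih, if_pos (by omega), show n + 1 - a = n - a + 1 by omega,
      Finset.sum_range_succ _ (n - a + 1)]

/-- Full periods of length `q * d` give `q * (1 + ⋯ + d)` each, then come the completed runs of
length `q` with constant digit, then the current partial run. -/
theorem sum_range_one_add_digit {d q : ℕ} (hd : 0 < d) (hq : 0 < q) (s : ℕ) :
    ∑ t ∈ Finset.range (s + 1), ((1 : ℤ) + ((t / q % d : ℕ) : ℤ)) =
      q * (((s / (q * d) : ℕ) : ℤ) * ((d + 1).choose 2 : ℤ) +
        ((s / q % d + 1).choose 2 : ℤ)) + ((s / q % d : ℕ) + 1) * ((s % q : ℕ) + 1) := by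
  induction s with
  | zero => simp
  | succ s ih =>
    rw [Finset.sum_range_succ, ih]
    rw [← Nat.div_div_eq_div_mul, ← Nat.div_div_eq_div_mul]
    have hch (m : ℕ) : (((m + 1 + 1).choose 2 : ℕ) : ℤ) = (m + 1) + ((m + 1).choose 2 : ℕ) := by
      rw [Nat.choose_succ_succ' (m + 1) 1, Nat.choose_one_right]
      push_cast
      ring
    by_cases h1 : s % q + 1 < q
    · have hdiv : (s + 1) / q = s / q := by
        have := Nat.div_add_mod s q
        refine Nat.div_eq_of_lt_le ?_ ?_
        · rw [mul_comm]; omega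
        · rw [Nat.succ_mul, mul_comm]; omega
      have hmod : (s + 1) % q = s % q + 1 := by
        have e1 := Nat.div_add_mod s q
        have e2 := Nat.div_add_mod (s + 1) q
        rw [hdiv] at e2
        omega
      rw [hdiv, hmod]
      push_cast
      ring
    · have hr : s % q + 1 = q := by
        have := Nat.mod_lt s hq
        omega
      have e1 := Nat.div_add_mod s q
      have hs : s + 1 = q * (s / q + 1) := by rw [mul_add]; omega
      have hdiv : (s + 1) / q = s / q + 1 := by rw [hs, Nat.mul_div_cancel_left _ hq]
      have hmod : (s + 1) % q = 0 := by rw [hs, Nat.mul_mod_right]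
      have hrz : ((s % q : ℕ) : ℤ) = q - 1 := by omega
      rw [hdiv, hmod, hrz]
      generalize s / q = a
      by_cases h2 : a % d + 1 < d
      · have hdiv2 : (a + 1) / d = a / d := by
          have := Nat.div_add_mod a d
          refine Nat.div_eq_of_lt_le ?_ ?_
          · rw [mul_comm]; omega
          · rw [Nat.succ_mul, mul_comm]; omega
        have hmod2 : (a + 1) % d = a % d + 1 := by
          have e1 := Nat.div_add_mod a d
          have e2 := Nat.div_add_mod (a + 1) d
          rw [hdiv2] at e2
          omega
        rw [hdiv2, hmod2, hch]
        push_cast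
        ring
      · have hr2 : a % d + 1 = d := by
          have := Nat.mod_lt a hd
          omega
        have e1 := Nat.div_add_mod a d
        have hs2 : a + 1 = d * (a / d + 1) := by rw [mul_add]; omega
        have hdiv2 : (a + 1) / d = a / d + 1 := by rw [hs2, Nat.mul_div_cancel_left _ hd]
        have hmod2 : (a + 1) % d = 0 := by rw [hs2, Nat.mul_mod_right]
        rw [hdiv2, hmod2, hr2]
        have hdz : ((a % d : ℕ) : ℤ) = d - 1 := by omega
        obtain ⟨c, rfl⟩ : ∃ c, d = c + 1 := ⟨d - 1, by omega⟩
        rw [hdz, hch]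
        push_cast
        simp
        ring

/-- The two numbers differ by `d^(k+1)` minus twice `d^(i+1) + ⋯ + d^k`, a multiple of `d^(i+1)`. -/
theorem labelValue_mod {d k n i : ℕ} (hd : 2 ≤ d) (hk : nIdx d k ≤ n) (hi : i ≤ k)
    (hm : mIdx d i ≤ n) : labelValue d k n % d ^ (i + 1) = (n - mIdx d i) % d ^ (i + 1) := by
  obtain ⟨c, hc⟩ : ∃ c, ∑ j ∈ Finset.range (k + 1), d ^ j =
      ∑ j ∈ Finset.range (i + 1), d ^ j + d ^ (i + 1) * c := by
    obtain ⟨t, rfl⟩ := Nat.exists_eq_add_of_le hi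
    refine ⟨∑ j ∈ Finset.range t, d ^ j, ?_⟩
    rw [show i + t + 1 = (i + 1) + t by ring, Finset.sum_range_add, Finset.mul_sum]
    simp only [pow_add]
  obtain ⟨e, he⟩ : d ^ (i + 1) ∣ d ^ (k + 1) := pow_dvd_pow d (by omega)
  have hval : labelValue d k n + d ^ (i + 1) * (2 * c) = n - mIdx d i + d ^ (i + 1) * e := by
    rw [← he, labelValue, Nat.sub_mul, one_mul, ← pow_succ']
    have h1 := nIdx_eq d k
    have h2 := mIdx_eq d i
    have h3 : d ^ k ≤ d ^ (k + 1) := Nat.pow_le_pow_right (by omega) (by omega)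
    have h4 : d ^ (i + 1) * (2 * c) = 2 * (d ^ (i + 1) * c) := by ring
    rw [Finset.sum_range_succ _ k] at hc
    omega
  rw [← Nat.add_mul_mod_self_left (labelValue d k n) _ (2 * c), hval, Nat.add_mul_mod_self_left]

theorem labelDigit_eq {d k n i : ℕ} (hd : 2 ≤ d) (hk : nIdx d k ≤ n) (hi : i ≤ k)
    (hm : mIdx d i ≤ n) : labelDigit d k n i = (n - mIdx d i) / d ^ i % d := by
  have h := labelValue_mod hd hk hi hm
  rw [labelDigit, ← Nat.mod_mul_right_div_self, ← Nat.mod_mul_right_div_self, ← pow_succ, h]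

theorem labelTail_eq {d k n i : ℕ} (hd : 2 ≤ d) (hk : nIdx d k ≤ n) (hi : i ≤ k)
    (hm : mIdx d i ≤ n) : labelTail d k n i = (n - mIdx d i) % d ^ i := by
  have h := labelValue_mod hd hk hi hm
  have hdvd : d ^ i ∣ d ^ (i + 1) := pow_dvd_pow d (by omega)
  rw [labelTail_eq_mod, ← Nat.mod_mod_of_dvd _ hdvd, h, Nat.mod_mod_of_dvd _ hdvd]

theorem nIdx_mono (d : ℕ) : Monotone (nIdx d) := by
  refine monotone_nat_of_le_succ fun k => ?_
  rw [nIdx, nIdx, Finset.sum_range_succ, mul_add]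
  omega

theorem mIdx_le_nIdx (d : ℕ) {i k : ℕ} (hi : i < k) : mIdx d i ≤ nIdx d k := by
  refine le_trans ?_ (nIdx_mono d (show i + 1 ≤ k from hi))
  rw [mIdx_eq, nIdx_eq]
  omega

theorem sum_odd_coeff {d n i : ℕ} (hd : 2 ≤ d) (hn : nIdx d i ≤ n) :
    ∑ x ∈ Finset.range n, ((d : ℤ) ^ i * if 1 ≤ (parentIndex d)^[i] x then 1 else 0) =
      (d : ℤ) ^ i * ((n : ℤ) - nIdx d i + 1) := by
  simp only [one_le_iterate_parentIndex hd]
  rw [← Finset.mul_sum, sum_range_ite_le _ _ (by rw [nIdx]; omega) hn (fun _ => 1)]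
  simp only [Finset.sum_const, Finset.card_range, nsmul_eq_mul, mul_one]
  push_cast [hn]
  rfl

theorem sum_even_coeff {d k n i : ℕ} (hd : 2 ≤ d) (hk : nIdx d k ≤ n) (hi : i ≤ k)
    (hm : mIdx d i ≤ n) :
    ∑ x ∈ Finset.range n, ((d : ℤ) ^ i * if 2 ≤ (parentIndex d)^[i] x then
        1 + ((((parentIndex d)^[i] x - 2) % d : ℕ) : ℤ) else 0) =
      (d : ℤ) ^ (2 * i) * (((n : ℤ) - mIdx d i) / (d : ℤ) ^ (i + 1)) * ((d + 1).choose 2 : ℤ) +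
        (d : ℤ) ^ (2 * i) * ((labelDigit d k n i + 1).choose 2 : ℤ) +
        (d : ℤ) ^ i * ((labelDigit d k n i : ℤ) + 1) * ((labelTail d k n i : ℤ) + 1) := by
  simp only [two_le_iterate_parentIndex hd, iterate_parentIndex_sub_two]
  rw [← Finset.mul_sum, sum_range_ite_le _ _ (by rw [mIdx]; omega) hm
    (fun t => 1 + ((t / d ^ i % d : ℕ) : ℤ)), sum_range_one_add_digit (by omega) (by positivity),
    labelDigit_eq hd hk hi hm, labelTail_eq hd hk hi hm, ← pow_succ, ← Nat.cast_sub hm]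
  push_cast
  ring

theorem sum_even_coeff_eq_zero {d n i : ℕ} (hd : 2 ≤ d) (hm : n < mIdx d i) :
    ∑ x ∈ Finset.range n, ((d : ℤ) ^ i * if 2 ≤ (parentIndex d)^[i] x then
        1 + ((((parentIndex d)^[i] x - 2) % d : ℕ) : ℤ) else 0) = 0 := by
  refine Finset.sum_eq_zero fun x hx => ?_
  rw [Finset.mem_range] at hx
  rw [if_neg (by rw [two_le_iterate_parentIndex hd]; omega), mul_zero]

theorem sum_rowPoly {d n k : ℕ} (hd : 2 ≤ d) (hk : nIdx d k ≤ n) (hk' : n < nIdx d (k + 1)) :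
    ∑ x ∈ Finset.range n, rowPoly d x =
      ∑ i ∈ Finset.range (k + 1),
        C ((d : ℤ) ^ i * ((n : ℤ) - nIdx d i + 1)) * X ^ (2 * i + 1) +
      ∑ i ∈ Finset.range (k + 1), C (∑ x ∈ Finset.range n,
        ((d : ℤ) ^ i * if 2 ≤ (parentIndex d)^[i] x then
          1 + ((((parentIndex d)^[i] x - 2) % d : ℕ) : ℤ) else 0)) * X ^ (2 * i + 2) := by
  have hrow : ∀ x ∈ Finset.range n, (parentIndex d)^[k + 1] x = 0 := by
    intro x hx
    rw [Finset.mem_range] at hx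
    have := one_le_iterate_parentIndex hd (k + 1) x
    omega
  rw [Finset.sum_congr rfl fun x hx => rowPoly_eq_sum d (k + 1) x (hrow x hx), Finset.sum_comm,
    ← Finset.sum_add_distrib]
  refine Finset.sum_congr rfl fun i hi => ?_
  rw [Finset.mem_range] at hi
  rw [Finset.sum_add_distrib, ← Finset.sum_mul, ← Finset.sum_mul, ← map_sum, ← map_sum,
    sum_odd_coeff hd ((nIdx_mono d (show i ≤ k by omega)).trans hk)]

end Sums

theorem mainTheorem2 (d n k : ℕ) (hd : 2 ≤ d) (hk : nIdx d k ≤ n) (hk' : n < nIdx d (k + 1)) :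
    (n < mIdx d k → wienerPoly (dendrimer n d) = dendrimerFormula d n k k) ∧
    (mIdx d k ≤ n → wienerPoly (dendrimer n d) = dendrimerFormula d n k (k + 1)) := by
  rw [wienerPoly_dendrimer hd, sum_rowPoly hd hk hk']
  constructor
  · intro hm
    -- Below `m_k` no node has a `k`-th ancestor of index at least 2, so the top even term vanishes.
    rw [dendrimerFormula, Finset.sum_range_succ (fun i => C (∑ x ∈ Finset.range n, _) * _) k,
      sum_even_coeff_eq_zero hd hm, C_0, zero_mul, add_zero]
    congr 1
    refine Finset.sum_congr rfl fun i hi => ?_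
    rw [Finset.mem_range] at hi
    rw [sum_even_coeff hd hk hi.le ((mIdx_le_nIdx d hi).trans hk)]
  · intro hm
    rw [dendrimerFormula]
    congr 1
    refine Finset.sum_congr rfl fun i hi => ?_
    rw [Finset.mem_range] at hi
    rcases Nat.lt_succ_iff_lt_or_eq.mp hi with h | rfl
    · rw [sum_even_coeff hd hk h.le ((mIdx_le_nIdx d h).trans hk)]
    · rw [sum_even_coeff hd hk le_rfl hm]
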